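/- Let $T>0$, and let $f\colon[0,T]\times\mathbb R^n\to\mathbb R$ be a $C^3$ function for which there are constants $a_0\ge 0$ and $c_0>0$ with $$\nabla_x f(t,x)\cdot x\ \ge\ c_0|x|^2-a_0\qquad\text{for all }(t,x)\in[0,T]\times\mathbb R^n .$$ Let $\tau\in[0,T]$ and let $\xi\in\mathbb R^n$ be a degenerate critical point of $f(\tau,\cdot)$, i.e. $\nabla_x f(\tau,\xi)=0$ and $\det\nabla_x^2 f(\tau,\xi)=0$, such that the Hessian matrix $\nabla_x^2 f(\tau,\xi)$ is positive semidefinite. Suppose that there is $\ell\in\mathbb R^n\setminus\{0\}$ with (a) $\ker\nabla_x^2 f(\tau,\xi)=\operatorname{span}(\ell)$; (c) $\sum_{i,j,k}f_{x_ix_jx_k}(\tau,\xi)\,\ell_i\ell_j\ell_k\neq 0$. Then, up to time translations, there is exactly one solution $w\not\equiv\xi$ of $$\dot w(s)=-\nabla_x f(\tau,w(s)),\qquad \lim_{s\to-\infty}w(s)=\xi .$$ More precisely, there is such a solution $w\colon\mathbb R\to\mathbb R^n$, and for every interval $I\subseteq\mathbb R$ unbounded below and every solution $v\colon I\to\mathbb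 R^n$ of this problem with $v\not\equiv\xi$ there is $c\in\mathbb R$ such that $v(s)=w(s+c)$ for all $s\in I$. -/

import Mathlib

open Set Filter Topology

noncomputable section

/-- The partial derivative `∂g/∂x_i` at `x`. -/
def partialD {n : ℕ} (i : Fin n) (g : EuclideanSpace ℝ (Fin n) → ℝ)
    (x : EuclideanSpace ℝ (Fin n)) : ℝ :=
  fderiv ℝ g x (EuclideanSpace.single i 1)

/-- The Hessian matrix `(∂²g/∂x_i∂x_j)` at `x`. -/
def hessianMatrix {n : ℕ} (g : EuclideanSpace ℝ (Fin n) → ℝ)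
    (x : EuclideanSpace ℝ (Fin n)) : Matrix (Fin n) (Fin n) ℝ :=
  Matrix.of fun i j => partialD i (partialD j g) x

/-- The cubic form `∑ (∂³g/∂x_i∂x_j∂x_k)(x) ℓ_i ℓ_j ℓ_k`. -/
def cubicTerm {n : ℕ} (g : EuclideanSpace ℝ (Fin n) → ℝ)
    (x l : EuclideanSpace ℝ (Fin n)) : ℝ :=
  ∑ i, ∑ j, ∑ k, partialD i (partialD j (partialD k g)) x * l i * l j * l k

/-- `f` is of class `C³` on `[0,T] × ℝⁿ` and
`∇ₓf(t,x) · x ≥ c₀|x|² - a₀` there, for some `a₀ ≥ 0` and `c₀ > 0`. Only the values of `f` at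
times in `[0,T]` are used. -/
def IsCoerciveC3 {n : ℕ} (T : ℝ) (f : ℝ → EuclideanSpace ℝ (Fin n) → ℝ) : Prop :=
  ContDiffOn ℝ 3 (fun p : ℝ × EuclideanSpace ℝ (Fin n) => f p.1 p.2) (Icc 0 T ×ˢ univ) ∧
    ∃ a₀ c₀ : ℝ, 0 ≤ a₀ ∧ 0 < c₀ ∧ ∀ t ∈ Icc 0 T, ∀ x : EuclideanSpace ℝ (Fin n),
      c₀ * ‖x‖ ^ 2 - a₀ ≤ inner ℝ (gradient (f t) x) x

/-- The set `Z_f` of pairs `(t,ξ)`, `t ∈ [0,T]`, such that `ξ` is a degenerate critical point of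
`f(t,·)`. -/
def degenerateSet {n : ℕ} (T : ℝ) (f : ℝ → EuclideanSpace ℝ (Fin n) → ℝ) :
    Set (ℝ × EuclideanSpace ℝ (Fin n)) :=
  {p | p.1 ∈ Icc 0 T ∧ gradient (f p.1) p.2 = 0 ∧ (hessianMatrix (f p.1) p.2).det = 0}

/-- `w` is a nontrivial solution on the time interval `I` (unbounded below) of
`ẇ = -∇g(w)` with `w(s) → ξ` as `s → -∞`; nontrivial means different from the
equilibrium solution `w ≡ ξ`. -/
structure IsSolutionIssuingFrom {n : ℕ} (g : EuclideanSpace ℝ (Fin n) → ℝ)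
    (ξ : EuclideanSpace ℝ (Fin n)) (I : Set ℝ) (w : ℝ → EuclideanSpace ℝ (Fin n)) : Prop where
  ordConnected : I.OrdConnected
  not_bddBelow : ¬ BddBelow I
  ode : ∀ s ∈ I, HasDerivWithinAt w (-gradient g (w s)) I s
  tendsto : Tendsto w atBot (𝓝 ξ)
  nontrivial : ∃ s ∈ I, w s ≠ ξ

end

/-!
Near `ξ` the field `F = -∇f(τ, ·)` contracts every direction except the kernel direction `ℓ`, along
which the third derivative of `f(τ, ·)` produces a quadratic drift; orient the unit vector `e` along
`ℓ` so that this drift points towards `e`. The transversal contraction makes a thin double cone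
around `ℝ e` forward invariant for *differences* of solutions, so any two solutions issuing from `ξ`
differ by a vector of the cone at all early times. Comparing with the constant solution `ξ` shows
that a nontrivial solution lies in the cone with apex `ξ`, where the drift makes its height
`⟨e, w - ξ⟩` increase from `0`. Hence two nontrivial solutions, translated in time so that their
heights agree at one instant, have there a difference in the cone of height zero: they coincide.

For existence, shoot from the points `ξ + η e` with `η` small. Such a trajectory stays in the cone
until its height reaches a fixed level, and by continuity `η` can be chosen so that this takes any
prescribed time. The points of that level whose backward trajectories stay in the cone for time `n`
thus form nested nonempty compact sets, and a point of their intersection lies on a trajectory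
issuing from `ξ`.
-/

section RealLine

theorem le_max_zero_of_deriv_nonpos_of_pos {U U' : ℝ → ℝ} {a b : ℝ} (hab : a ≤ b)
    (hU : ∀ s ∈ Icc a b, HasDerivWithinAt U (U' s) (Icc a b) s)
    (h : ∀ s ∈ Icc a b, 0 < U s → U' s ≤ 0) : U b ≤ max (U a) 0 := by
  -- compare with the strict supersolutions `max (U a) 0 + ε * (1 + (s - a))` and let `ε → 0`
  have le_supersolution : ∀ ε > 0, U b ≤ max (U a) 0 + ε * (1 + (b - a)) := by
    intro ε hε
    refine image_le_of_deriv_right_lt_deriv_boundary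
      (B := fun s => max (U a) 0 + ε * (1 + (s - a))) (B' := fun _ => ε)
      (fun s hs => (hU s hs).continuousWithinAt)
      (fun s hs => (hU s (Ico_subset_Icc_self hs)).mono_of_mem_nhdsWithin
        (Icc_mem_nhdsGE_of_mem hs)) ?_ ?_ ?_ (right_mem_Icc.2 hab)
    · have := le_max_left (U a) 0
      simp only [sub_self, add_zero, mul_one]
      linarith
    · intro s
      simpa using ((((hasDerivAt_id s).sub_const a).const_add 1).const_mul ε).const_add
        (max (U a) 0)
    · intro s hs hUs
      have hpos : 0 < U s := by
        have : 0 < ε * (1 + (s - a)) := mul_pos hε (by linarith [hs.1])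
        linarith [le_max_right (U a) 0]
      exact (h s (Ico_subset_Icc_self hs) hpos).trans_lt hε
  have hlim : Tendsto (fun ε : ℝ => max (U a) 0 + ε * (1 + (b - a))) (𝓝[>] 0)
      (𝓝 (max (U a) 0)) := by
    have : Continuous fun ε : ℝ => max (U a) 0 + ε * (1 + (b - a)) := by fun_prop
    simpa using (this.tendsto 0).mono_left nhdsWithin_le_nhds
  exact ge_of_tendsto hlim (eventually_mem_nhdsWithin.mono le_supersolution)

theorem exists_eq_and_forall_mem_Icc_le {f : ℝ → ℝ} {a b c : ℝ} (hab : a ≤ b)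
    (hf : ContinuousOn f (Icc a b)) (ha : f a ≤ c) (hb : c ≤ f b) :
    ∃ t ∈ Icc a b, f t = c ∧ ∀ s ∈ Icc a t, f s ≤ c := by
  have hcompact : IsCompact (Icc a b ∩ f ⁻¹' {c}) :=
    isCompact_Icc.of_isClosed_subset (hf.preimage_isClosed_of_isClosed isClosed_Icc
      isClosed_singleton) inter_subset_left
  obtain ⟨t, ⟨ht, htc⟩, hleast⟩ :=
    hcompact.exists_isLeast (intermediate_value_Icc hab hf ⟨ha, hb⟩)
  refine ⟨t, ht, htc, fun s hs => ?_⟩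
  by_contra! hcs
  obtain ⟨s', hs', hs'c⟩ := intermediate_value_Icc hs.1
    (hf.mono (Icc_subset_Icc_right (hs.2.trans ht.2))) ⟨ha, hcs.le⟩
  have hts' : t ≤ s' := hleast ⟨⟨hs'.1, hs'.2.trans (hs.2.trans ht.2)⟩, hs'c⟩
  have hst : s = t := le_antisymm hs.2 (hts'.trans hs'.2)
  exact hcs.ne' (hst ▸ htc)

end RealLine

section IntegralCurves

variable {E : Type*} [NormedAddCommGroup E] [NormedSpace ℝ E] {F : E → E} {I : Set ℝ} {v w : ℝ → E}

theorem exists_lipschitzOnWith_image_Icc (hF : ContDiff ℝ 1 F) {a b : ℝ}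
    (hv : ContinuousOn v (Icc a b)) (hw : ContinuousOn w (Icc a b)) :
    ∃ K, LipschitzOnWith K F (v '' Icc a b ∪ w '' Icc a b) :=
  (hF.locallyLipschitz.locallyLipschitzOn).exists_lipschitzOnWith_of_compact
    ((isCompact_Icc.image_of_continuousOn hv).union (isCompact_Icc.image_of_continuousOn hw))

theorem integralCurve_eqOn_Icc_of_eq_left (hF : ContDiff ℝ 1 F) {a b : ℝ}
    (hv : IsIntegralCurveOn v (fun _ => F) (Icc a b))
    (hw : IsIntegralCurveOn w (fun _ => F) (Icc a b)) (h : v a = w a) : EqOn v w (Icc a b) := by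
  obtain ⟨K, hK⟩ := exists_lipschitzOnWith_image_Icc hF hv.continuousOn hw.continuousOn
  refine ODE_solution_unique_of_mem_Icc_right (v := fun _ => F)
    (s := fun _ => v '' Icc a b ∪ w '' Icc a b) (fun _ _ => hK) hv.continuousOn
    (fun s hs => ?_) (fun s hs => .inl (mem_image_of_mem v (Ico_subset_Icc_self hs)))
    hw.continuousOn (fun s hs => ?_)
    (fun s hs => .inr (mem_image_of_mem w (Ico_subset_Icc_self hs))) h
  · exact (hv s (Ico_subset_Icc_self hs)).mono_of_mem_nhdsWithin (Icc_mem_nhdsGE_of_mem hs)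
  · exact (hw s (Ico_subset_Icc_self hs)).mono_of_mem_nhdsWithin (Icc_mem_nhdsGE_of_mem hs)

theorem integralCurve_eqOn_Icc_of_eq_right (hF : ContDiff ℝ 1 F) {a b : ℝ}
    (hv : IsIntegralCurveOn v (fun _ => F) (Icc a b))
    (hw : IsIntegralCurveOn w (fun _ => F) (Icc a b)) (h : v b = w b) : EqOn v w (Icc a b) := by
  obtain ⟨K, hK⟩ := exists_lipschitzOnWith_image_Icc hF hv.continuousOn hw.continuousOn
  refine ODE_solution_unique_of_mem_Icc_left (v := fun _ => F)
    (s := fun _ => v '' Icc a b ∪ w '' Icc a b) (fun _ _ => hK) hv.continuousOn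
    (fun s hs => ?_) (fun s hs => .inl (mem_image_of_mem v (Ioc_subset_Icc_self hs)))
    hw.continuousOn (fun s hs => ?_)
    (fun s hs => .inr (mem_image_of_mem w (Ioc_subset_Icc_self hs))) h
  · exact (hv s (Ioc_subset_Icc_self hs)).mono_of_mem_nhdsWithin (Icc_mem_nhdsLE_of_mem hs)
  · exact (hw s (Ioc_subset_Icc_self hs)).mono_of_mem_nhdsWithin (Icc_mem_nhdsLE_of_mem hs)

theorem integralCurve_eqOn_of_eq (hF : ContDiff ℝ 1 F) (hI : I.OrdConnected)
    (hv : IsIntegralCurveOn v (fun _ => F) I) (hw : IsIntegralCurveOn w (fun _ => F) I)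
    {s₀ : ℝ} (hs₀ : s₀ ∈ I) (h : v s₀ = w s₀) : EqOn v w I := by
  intro t ht
  rcases le_total s₀ t with hst | hts
  · exact integralCurve_eqOn_Icc_of_eq_left hF (hv.mono (hI.out hs₀ ht))
      (hw.mono (hI.out hs₀ ht)) h (right_mem_Icc.2 hst)
  · exact integralCurve_eqOn_Icc_of_eq_right hF (hv.mono (hI.out ht hs₀))
      (hw.mono (hI.out ht hs₀)) h (left_mem_Icc.2 hts)

open scoped Manifold in
theorem isMIntegralCurveOn_iff_isIntegralCurveOn :
    IsMIntegralCurveOn (I := 𝓘(ℝ, E)) v (fun x => F x) I ↔ IsIntegralCurveOn v (fun _ => F) I :=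
  forall₂_congr fun _ _ => hasMFDerivWithinAt_iff_hasFDerivWithinAt

theorem exists_isIntegralCurveOn_Ioo_of_lipschitzWith [CompleteSpace E] {K C : NNReal}
    (hK : LipschitzWith K F) (hC : ∀ x, ‖F x‖ ≤ C) (x : E) (a : ℝ) :
    ∃ γ : ℝ → E, γ 0 = x ∧ IsIntegralCurveOn γ (fun _ => F) (Ioo (-a) a) := by
  have hpl : IsPicardLindelof (fun _ => F) (tmin := -|a|) (tmax := |a|) ⟨0, by simp⟩ x
      (C * ‖a‖₊) 0 C K :=
    { lipschitzOnWith := fun t _ => hK.lipschitzOnWith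
      continuousOn := fun x _ => continuousOn_const
      norm_le := fun t _ x _ => hC x
      mul_max_le := by simp }
  obtain ⟨γ, hγ0, hγ⟩ := hpl.exists_eq_forall_mem_Icc_hasDerivWithinAt₀
  exact ⟨γ, hγ0, IsIntegralCurveOn.mono hγ
    (Ioo_subset_Icc_self.trans (Icc_subset_Icc (neg_le_neg (le_abs_self a)) (le_abs_self a)))⟩

open scoped Manifold in
theorem exists_isIntegralCurve_of_lipschitzWith [CompleteSpace E] (hF : ContDiff ℝ 1 F)
    {K C : NNReal} (hK : LipschitzWith K F) (hC : ∀ x, ‖F x‖ ≤ C) (x : E) :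
    ∃ γ : ℝ → E, γ 0 = x ∧ IsIntegralCurve γ fun _ => F := by
  obtain ⟨γ, hγ0, hγ⟩ := (exists_isMIntegralCurve_iff_exists_isMIntegralCurveOn_Ioo
    (I := 𝓘(ℝ, E)) (v := fun x => F x)
    (fun y => contMDiffAt_vectorSpace_iff_contDiffAt.2 hF.contDiffAt) x).2 fun a => by
      simpa only [isMIntegralCurveOn_iff_isIntegralCurveOn] using
        exists_isIntegralCurveOn_Ioo_of_lipschitzWith hK hC x a
  exact ⟨γ, hγ0, isIntegralCurveOn_univ.1
    (isMIntegralCurveOn_iff_isIntegralCurveOn.1 (hγ.isMIntegralCurveOn univ))⟩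

theorem dist_integralCurve_le {K : NNReal} (hF : LipschitzWith K F)
    (hv : IsIntegralCurve v fun _ => F) (hw : IsIntegralCurve w fun _ => F) (t : ℝ) :
    dist (v t) (w t) ≤ dist (v 0) (w 0) * Real.exp (K * |t|) := by
  have forward : ∀ {G : E → E} {v w : ℝ → E} {t : ℝ}, LipschitzWith K G →
      (IsIntegralCurve v fun _ => G) → (IsIntegralCurve w fun _ => G) → 0 ≤ t →
      dist (v t) (w t) ≤ dist (v 0) (w 0) * Real.exp (K * t) := by
    intro G v w t hG hv hw ht
    simpa using dist_le_of_trajectories_ODE (v := fun _ => G) (fun _ => hG) (a := 0) (b := t)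
      hv.continuous.continuousOn (fun s _ => (hv s).hasDerivWithinAt)
      hw.continuous.continuousOn (fun s _ => (hw s).hasDerivWithinAt) le_rfl t (right_mem_Icc.2 ht)
  rcases le_total 0 t with ht | ht
  · simpa only [abs_of_nonneg ht] using forward hF hv hw ht
  · have hreverse : ∀ {u : ℝ → E}, (IsIntegralCurve u fun _ => F) →
        IsIntegralCurve (fun s => u (-s)) fun _ => -F := fun hu s => by
      simpa [Function.comp_def] using (hu (-s)).scomp s (hasDerivAt_neg s)
    simpa [abs_of_nonpos ht] using
      forward hF.neg (hreverse hv) (hreverse hw) (neg_nonneg.2 ht)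

theorem exists_continuous_family_isIntegralCurve [CompleteSpace E] (hF : ContDiff ℝ 1 F)
    (hFc : HasCompactSupport F) :
    ∃ φ : E → ℝ → E, (∀ x, φ x 0 = x) ∧ (∀ x, IsIntegralCurve (φ x) fun _ => F) ∧
      ∀ t, Continuous fun x => φ x t := by
  obtain ⟨K, hK⟩ := hF.lipschitzWith_of_hasCompactSupport hFc one_ne_zero
  obtain ⟨C, hC⟩ := hFc.exists_bound_of_continuous hF.continuous
  choose φ hφ0 hφ using exists_isIntegralCurve_of_lipschitzWith hF hK fun x =>
    (hC x).trans (Real.le_coe_toNNReal C)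
  refine ⟨φ, hφ0, hφ, fun t => ?_⟩
  have hlip : LipschitzWith (Real.exp (K * |t|)).toNNReal fun x => φ x t :=
    LipschitzWith.of_dist_le_mul fun x y => by
      simpa only [hφ0, Real.coe_toNNReal _ (Real.exp_pos _).le, mul_comm] using
        dist_integralCurve_le hK (hφ x) (hφ y) t
  exact hlip.continuous

theorem exists_contDiff_hasCompactSupport_eqOn_closedBall {E : Type*} [NormedAddCommGroup E]
    [InnerProductSpace ℝ E] [FiniteDimensional ℝ E] {F : E → E} {n : ℕ∞} (hF : ContDiff ℝ n F)
    {R : ℝ} (hR : 0 < R) :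
    ∃ G : E → E, ContDiff ℝ n G ∧ HasCompactSupport G ∧ EqOn F G (Metric.closedBall 0 R) ∧
      ∀ x, ∃ a : ℝ, 0 ≤ a ∧ G x = a • F x := by
  let χ : ContDiffBump (0 : E) := ⟨R, R + 1, hR, by linarith⟩
  refine ⟨fun x => χ x • F x, χ.contDiff.smul hF, χ.hasCompactSupport.smul_right, fun x hx => ?_,
    fun x => ⟨χ x, χ.nonneg, rfl⟩⟩
  simp only [χ.one_of_mem_closedBall hx, one_smul]

theorem norm_le_of_forall_inner_nonpos {E : Type*} [NormedAddCommGroup E] [InnerProductSpace ℝ E]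
    {F : E → E} {R : ℝ} (hR : 0 ≤ R) (hF : ∀ x, R ≤ ‖x‖ → inner ℝ x (F x) ≤ 0) {u : ℝ → E}
    {a b : ℝ} (hab : a ≤ b) (hu : IsIntegralCurveOn u (fun _ => F) (Icc a b)) (ha : ‖u a‖ ≤ R) :
    ‖u b‖ ≤ R := by
  have hnorm : ‖u b‖ ^ 2 - R ^ 2 ≤ max (‖u a‖ ^ 2 - R ^ 2) 0 := by
    refine le_max_zero_of_deriv_nonpos_of_pos (U := fun s => ‖u s‖ ^ 2 - R ^ 2) hab
      (fun s hs => (hu s hs).norm_sq.sub_const _) fun s _ hs => ?_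
    have hRs : R ≤ ‖u s‖ := le_of_sq_le_sq (by linarith) (norm_nonneg _)
    linarith [hF _ hRs]
  rw [max_eq_right (sub_nonpos.2 (pow_le_pow_left₀ (norm_nonneg _) ha 2))] at hnorm
  exact le_of_sq_le_sq (by linarith) hR

end IntegralCurves

section ConeFields

variable {E : Type*} [NormedAddCommGroup E] [InnerProductSpace ℝ E]

/-- The indefinite inner product `⟨u, v⟩ - κ ⟨e, u⟩ ⟨e, v⟩`. For a unit vector `e` and `κ ≥ 1` the
set `coneInner e κ u u ≤ 0` is a closed double cone around the line spanned by `e`, which shrinks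
to this line as `κ → 1`. -/
def coneInner (e : E) (κ : ℝ) (u v : E) : ℝ :=
  inner ℝ u v - κ * (inner ℝ e u * inner ℝ e v)

/-- The double cone with apex `ξ` around the line `ξ + ℝ e`, intersected with the open ball of
radius `r` around `ξ`. -/
def localCone (ξ e : E) (κ r : ℝ) : Set E :=
  {x ∈ Metric.ball ξ r | coneInner e κ (x - ξ) (x - ξ) ≤ 0}

/-- The part of the cone with apex `ξ` around the half-line `ξ + ℝ≥0 e` which lies below height
`ρ`, where the height of `x` is `⟨e, x - ξ⟩`. -/
def truncatedCone (ξ e : E) (κ ρ : ℝ) : Set E :=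
  {x | coneInner e κ (x - ξ) (x - ξ) ≤ 0 ∧ inner ℝ e (x - ξ) ∈ Icc 0 ρ}

/-- Near its zero `ξ` the field `F` does not expand the form `coneInner e κ` outside its cone, so
that the cone condition on the difference of two integral curves persists, and inside the cone with
apex `ξ` it drifts in the direction `e` at a quadratic rate. -/
structure IsConeField (F : E → E) (ξ e : E) (κ r c : ℝ) : Prop where
  norm_eq_one : ‖e‖ = 1
  one_le : 1 ≤ κ
  le_two : κ ≤ 2
  radius_pos : 0 < r
  drift_pos : 0 < c
  apply_eq_zero : F ξ = 0
  contract : ∀ x ∈ Metric.ball ξ r, ∀ y ∈ Metric.ball ξ r, 0 < coneInner e κ (x - y) (x - y) →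
    coneInner e κ (x - y) (F x - F y) ≤ 0
  drift : ∀ x ∈ localCone ξ e κ r, c * inner ℝ e (x - ξ) ^ 2 ≤ inner ℝ e (F x)

theorem continuous_coneInner_self (e : E) (κ : ℝ) : Continuous fun u => coneInner e κ u u := by
  unfold coneInner; fun_prop

theorem isClosed_truncatedCone (ξ e : E) (κ ρ : ℝ) : IsClosed (truncatedCone ξ e κ ρ) := by
  have hheight : Continuous fun x => inner ℝ e (x - ξ) := by fun_prop
  exact (isClosed_le ((continuous_coneInner_self e κ).comp (continuous_sub_right ξ))
    continuous_const).inter (isClosed_Icc.preimage hheight)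

theorem hasDerivWithinAt_coneInner_self (e : E) (κ : ℝ) {u : ℝ → E} {u' : E} {I : Set ℝ} {s : ℝ}
    (hu : HasDerivWithinAt u u' I s) :
    HasDerivWithinAt (fun t => coneInner e κ (u t) (u t)) (2 * coneInner e κ (u s) u') I s := by
  have hheight : HasDerivWithinAt (fun t => inner ℝ e (u t)) (inner ℝ e u') I s := by
    simpa using (hasDerivWithinAt_const s I e).inner ℝ hu
  refine ((hu.inner ℝ hu).sub ((hheight.mul hheight).const_mul κ)).congr_deriv ?_
  rw [coneInner, real_inner_comm u' (u s)]
  ring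

namespace IsConeField

variable {F : E → E} {ξ e : E} {κ r c : ℝ}

theorem congr (h : IsConeField F ξ e κ r c) {G : E → E} (hFG : EqOn F G (Metric.ball ξ r)) :
    IsConeField G ξ e κ r c where
  norm_eq_one := h.norm_eq_one
  one_le := h.one_le
  le_two := h.le_two
  radius_pos := h.radius_pos
  drift_pos := h.drift_pos
  apply_eq_zero := by rw [← hFG (Metric.mem_ball_self h.radius_pos), h.apply_eq_zero]
  contract x hx y hy := by rw [← hFG hx, ← hFG hy]; exact h.contract x hx y hy
  drift x hx := by rw [← hFG hx.1]; exact h.drift x hx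

theorem norm_sq_le (h : IsConeField F ξ e κ r c) {u : E} (hu : coneInner e κ u u ≤ 0) :
    ‖u‖ ^ 2 ≤ 2 * inner ℝ e u ^ 2 := by
  have := mul_le_mul_of_nonneg_right h.le_two (sq_nonneg (inner ℝ e u))
  rw [coneInner, real_inner_self_eq_norm_sq, ← sq] at hu
  linarith

theorem eq_zero_of_inner_eq_zero (h : IsConeField F ξ e κ r c) {u : E}
    (hu : coneInner e κ u u ≤ 0) (h0 : inner ℝ e u = 0) : u = 0 := by
  simpa [h0] using h.norm_sq_le hu

theorem truncatedCone_subset_localCone (h : IsConeField F ξ e κ r c) :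
    truncatedCone ξ e κ (r / 2) ⊆ localCone ξ e κ r := by
  rintro x ⟨hx, hx0, hxr⟩
  refine ⟨mem_ball_iff_norm.2 (lt_of_pow_lt_pow_left₀ 2 h.radius_pos.le ?_), hx⟩
  nlinarith [h.norm_sq_le hx, pow_le_pow_left₀ hx0 hxr 2, h.radius_pos]

theorem inner_add_smul_sub (h : IsConeField F ξ e κ r c) (η : ℝ) :
    inner ℝ e (ξ + η • e - ξ) = η := by
  rw [add_sub_cancel_left, inner_smul_right, real_inner_self_eq_norm_sq, h.norm_eq_one]
  ring

theorem add_smul_mem_truncatedCone (h : IsConeField F ξ e κ r c) {η ρ : ℝ} (hη : η ∈ Icc 0 ρ) :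
    ξ + η • e ∈ truncatedCone ξ e κ ρ := by
  refine ⟨?_, by rwa [h.inner_add_smul_sub]⟩
  rw [coneInner, h.inner_add_smul_sub, add_sub_cancel_left, real_inner_self_eq_norm_sq, norm_smul,
    h.norm_eq_one, mul_one, Real.norm_eq_abs, sq_abs]
  nlinarith [h.one_le, sq_nonneg η]

theorem coneInner_sub_le_max (h : IsConeField F ξ e κ r c) {u v : ℝ → E} {a b : ℝ} (hab : a ≤ b)
    (hu : IsIntegralCurveOn u (fun _ => F) (Icc a b))
    (hv : IsIntegralCurveOn v (fun _ => F) (Icc a b))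
    (hur : MapsTo u (Icc a b) (Metric.ball ξ r)) (hvr : MapsTo v (Icc a b) (Metric.ball ξ r)) :
    coneInner e κ (u b - v b) (u b - v b) ≤ max (coneInner e κ (u a - v a) (u a - v a)) 0 :=
  le_max_zero_of_deriv_nonpos_of_pos (U := fun s => coneInner e κ (u s - v s) (u s - v s)) hab
    (fun s hs => hasDerivWithinAt_coneInner_self e κ ((hu s hs).sub (hv s hs))) fun s hs hpos => by
      linarith [h.contract _ (hur hs) _ (hvr hs) hpos]

theorem mapsTo_localCone (h : IsConeField F ξ e κ r c) {u : ℝ → E} {a b : ℝ}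
    (hu : IsIntegralCurveOn u (fun _ => F) (Icc a b)) (hur : MapsTo u (Icc a b) (Metric.ball ξ r))
    (ha : u a ∈ localCone ξ e κ r) : MapsTo u (Icc a b) (localCone ξ e κ r) := by
  intro s hs
  have hsub : Icc a s ⊆ Icc a b := Icc_subset_Icc_right hs.2
  have := h.coneInner_sub_le_max hs.1 (hu.mono hsub)
    ((isIntegralCurve_const fun _ => h.apply_eq_zero).isIntegralCurveOn _) (hur.mono_left hsub)
    fun _ _ => Metric.mem_ball_self h.radius_pos
  exact ⟨hur hs, this.trans (max_eq_right ha.2).le⟩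

theorem coneInner_sub_nonpos_of_tendsto (h : IsConeField F ξ e κ r c) {u v : ℝ → E} {s₀ : ℝ}
    (hu : IsIntegralCurveOn u (fun _ => F) (Iic s₀))
    (hv : IsIntegralCurveOn v (fun _ => F) (Iic s₀))
    (hur : MapsTo u (Iic s₀) (Metric.ball ξ r)) (hvr : MapsTo v (Iic s₀) (Metric.ball ξ r))
    (hul : Tendsto u atBot (𝓝 ξ)) (hvl : Tendsto v atBot (𝓝 ξ)) :
    coneInner e κ (u s₀ - v s₀) (u s₀ - v s₀) ≤ 0 := by
  have hlim : Tendsto (fun s => max (coneInner e κ (u s - v s) (u s - v s)) 0) atBot (𝓝 0) := by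
    simpa [coneInner, Function.comp_def] using
      (((continuous_coneInner_self e κ).tendsto _).comp (hul.sub hvl)).max
        (tendsto_const_nhds (x := (0 : ℝ)))
  refine ge_of_tendsto hlim ((eventually_le_atBot s₀).mono fun s hs => ?_)
  exact h.coneInner_sub_le_max hs (hu.mono Icc_subset_Iic_self) (hv.mono Icc_subset_Iic_self)
    (hur.mono_left Icc_subset_Iic_self) (hvr.mono_left Icc_subset_Iic_self)

theorem inner_add_mul_le (h : IsConeField F ξ e κ r c) {u : ℝ → E} {a b m : ℝ} (hab : a ≤ b)
    (hu : IsIntegralCurveOn u (fun _ => F) (Icc a b)) (huC : MapsTo u (Icc a b) (localCone ξ e κ r))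
    (hm : ∀ s ∈ Icc a b, m ≤ inner ℝ e (u s - ξ) ^ 2) :
    inner ℝ e (u a - ξ) + c * m * (b - a) ≤ inner ℝ e (u b - ξ) := by
  have hgrowth := le_max_zero_of_deriv_nonpos_of_pos
    (U := fun s => inner ℝ e (u a - ξ) + c * m * (s - a) - inner ℝ e (u s - ξ))
    (U' := fun s => c * m - inner ℝ e (F (u s))) hab (fun s hs => ?_) (fun s hs _ => ?_)
  · simp only [sub_self, mul_zero, add_zero, max_self] at hgrowth
    linarith
  · have hheight : HasDerivWithinAt (fun t => inner ℝ e (u t - ξ)) (inner ℝ e (F (u s)))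
        (Icc a b) s := by
      simpa using (hasDerivWithinAt_const s (Icc a b) e).inner ℝ ((hu s hs).sub_const ξ)
    have hlinear : HasDerivWithinAt (fun t => inner ℝ e (u a - ξ) + c * m * (t - a)) (c * m)
        (Icc a b) s := by
      simpa using ((((hasDerivAt_id s).sub_const a).const_mul (c * m)).const_add
        (inner ℝ e (u a - ξ))).hasDerivWithinAt
    exact hlinear.sub hheight
  · linarith [h.drift _ (huC hs), mul_le_mul_of_nonneg_left (hm s hs) h.drift_pos.le]

theorem inner_monotoneOn (h : IsConeField F ξ e κ r c) {u : ℝ → E} {I : Set ℝ}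
    (hI : I.OrdConnected) (hu : IsIntegralCurveOn u (fun _ => F) I)
    (huC : MapsTo u I (localCone ξ e κ r)) : MonotoneOn (fun s => inner ℝ e (u s - ξ)) I := by
  intro a ha b hb hab
  simpa using h.inner_add_mul_le (m := 0) hab (hu.mono (hI.out ha hb))
    (huC.mono_left (hI.out ha hb)) fun s _ => sq_nonneg _

theorem mapsTo_truncatedCone (h : IsConeField F ξ e κ r c) {u : ℝ → E}
    (hu : IsIntegralCurve u fun _ => F) {a b : ℝ} (ha : u a ∈ truncatedCone ξ e κ (r / 2))
    (hle : ∀ t ∈ Icc a b, inner ℝ e (u t - ξ) ≤ r / 2) :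
    MapsTo u (Icc a b) (truncatedCone ξ e κ (r / 2)) := by
  have hclosed : IsClosed (u ⁻¹' truncatedCone ξ e κ (r / 2) ∩ Icc a b) :=
    ((isClosed_truncatedCone ξ e κ (r / 2)).preimage hu.continuous).inter isClosed_Icc
  refine hclosed.Icc_subset_of_forall_exists_gt ha ?_
  rintro x ⟨hxC, hx⟩ y (hxy : x < y)
  have hxL := h.truncatedCone_subset_localCone hxC
  obtain ⟨z, hz, hball⟩ : ∃ z ∈ Ioc x (min y b), Icc x z ⊆ u ⁻¹' Metric.ball ξ r := by
    have hnear : ∀ᶠ z in 𝓝[>] x, Icc x z ⊆ u ⁻¹' Metric.ball ξ r :=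
      (tendsto_const_nhds.Icc (tendsto_id.mono_left nhdsWithin_le_nhds)).eventually
        (Filter.Eventually.smallSets
          (hu.continuous.continuousAt.eventually (Metric.isOpen_ball.mem_nhds hxL.1)))
    exact ((eventually_mem_set.2 (Ioc_mem_nhdsGT (lt_min hxy hx.2))).and hnear).exists
  have huz := hu.isIntegralCurveOn (Icc x z)
  have hcone := h.mapsTo_localCone huz hball hxL
  have hzmem : z ∈ Icc x z := right_mem_Icc.2 hz.1.le
  refine ⟨z, ⟨(hcone hzmem).2, ?_, hle z ⟨hx.1.trans hz.1.le, hz.2.trans (min_le_right _ _)⟩⟩,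
    hz.1, hz.2.trans (min_le_left _ _)⟩
  exact hxC.2.1.trans (h.inner_monotoneOn ordConnected_Icc huz hcone
    (left_mem_Icc.2 hz.1.le) hzmem hz.1.le)

theorem exists_le_inner (h : IsConeField F ξ e κ r c) {u : ℝ → E}
    (hu : IsIntegralCurve u fun _ => F) (hu0 : u 0 ∈ truncatedCone ξ e κ (r / 2))
    (hpos : 0 < inner ℝ e (u 0 - ξ)) :
    ∃ t, 0 ≤ t ∧ r / 2 ≤ inner ℝ e (u t - ξ) := by
  by_contra! hlt
  set η := inner ℝ e (u 0 - ξ)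
  have hrate : 0 < c * η ^ 2 := mul_pos h.drift_pos (pow_pos hpos 2)
  set T := r / 2 / (c * η ^ 2)
  have hT : 0 ≤ T := div_nonneg (half_pos h.radius_pos).le hrate.le
  have hcone : MapsTo u (Icc 0 T) (localCone ξ e κ r) :=
    (h.mapsTo_truncatedCone hu hu0 fun t ht => (hlt t ht.1).le).mono_right
      h.truncatedCone_subset_localCone
  have hmono := h.inner_monotoneOn ordConnected_Icc (hu.isIntegralCurveOn _) hcone
  have hgrowth := h.inner_add_mul_le (m := η ^ 2) hT (hu.isIntegralCurveOn _) hcone fun s hs =>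
    pow_le_pow_left₀ hpos.le (hmono (left_mem_Icc.2 hT) hs hs.1) 2
  rw [sub_zero, mul_div_cancel₀ _ hrate.ne'] at hgrowth
  linarith [hlt T hT]

theorem exists_inner_eq_and_mapsTo (h : IsConeField F ξ e κ r c) {u : ℝ → E}
    (hu : IsIntegralCurve u fun _ => F) (hu0 : u 0 ∈ truncatedCone ξ e κ (r / 2))
    (hpos : 0 < inner ℝ e (u 0 - ξ)) :
    ∃ t, 0 ≤ t ∧ inner ℝ e (u t - ξ) = r / 2 ∧
      MapsTo u (Icc 0 t) (truncatedCone ξ e κ (r / 2)) := by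
  obtain ⟨T, hT, hTr⟩ := h.exists_le_inner hu hu0 hpos
  have hheight : Continuous fun t => inner ℝ e (u t - ξ) :=
    continuous_const.inner (hu.continuous.sub continuous_const)
  obtain ⟨t, ht, htr, hle⟩ :=
    exists_eq_and_forall_mem_Icc_le hT hheight.continuousOn hu0.2.2 hTr
  exact ⟨t, ht.1, htr, h.mapsTo_truncatedCone hu hu0 hle⟩

theorem half_radius_le_mul_exp (h : IsConeField F ξ e κ r c) {K : NNReal} (hF : LipschitzWith K F)
    {u : ℝ → E} (hu : IsIntegralCurve u fun _ => F) {η : ℝ} (hη : 0 ≤ η) (hu0 : u 0 = ξ + η • e)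
    {t : ℝ} (ht : 0 ≤ t) (htr : inner ℝ e (u t - ξ) = r / 2) :
    r / 2 ≤ η * Real.exp (K * t) :=
  calc r / 2 = inner ℝ e (u t - ξ) := htr.symm
    _ ≤ ‖e‖ * ‖u t - ξ‖ := real_inner_le_norm _ _
    _ = dist (u t) ξ := by rw [h.norm_eq_one, one_mul, dist_eq_norm]
    _ ≤ dist (u 0) ξ * Real.exp (K * |t|) :=
      dist_integralCurve_le hF hu (isIntegralCurve_const fun _ => h.apply_eq_zero) t
    _ = η * Real.exp (K * t) := by
      rw [hu0, dist_eq_norm, add_sub_cancel_left, norm_smul, h.norm_eq_one, mul_one,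
        Real.norm_of_nonneg hη, abs_of_nonneg ht]

theorem exists_mapsTo_Icc_truncatedCone (h : IsConeField F ξ e κ r c) {K : NNReal}
    (hF : LipschitzWith K F) (hex : ∀ x, ∃ u : ℝ → E, u 0 = x ∧ IsIntegralCurve u fun _ => F)
    (T : ℝ) : ∃ u : ℝ → E, (IsIntegralCurve u fun _ => F) ∧ inner ℝ e (u 0 - ξ) = r / 2 ∧
      MapsTo u (Icc (-T) 0) (truncatedCone ξ e κ (r / 2)) := by
  have hr := half_pos h.radius_pos
  -- starting closer to `ξ` than `r / 2 * exp (- K T)`, the curve needs more than time `T`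
  have hexp : 0 < Real.exp (K * T) := Real.exp_pos _
  set η := min (r / 2) (r / 2 / Real.exp (K * T) / 2)
  have hη : 0 < η := lt_min hr (by positivity)
  obtain ⟨u, hu0, hu⟩ := hex (ξ + η • e)
  obtain ⟨t, ht, htr, htC⟩ := h.exists_inner_eq_and_mapsTo hu
    (hu0 ▸ h.add_smul_mem_truncatedCone ⟨hη.le, min_le_left _ _⟩)
    (by rwa [hu0, h.inner_add_smul_sub])
  have hTt : T ≤ t := by
    by_contra! htT
    have hηexp : η * Real.exp (K * T) ≤ r / 2 / 2 := by
      rw [← le_div_iff₀ hexp, div_right_comm]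
      exact min_le_right _ _
    have hle : η * Real.exp (K * t) ≤ η * Real.exp (K * T) := by gcongr
    linarith [h.half_radius_le_mul_exp hF hu hη.le hu0 ht htr]
  refine ⟨u ∘ (· + t), hu.comp_add t, by simpa using htr, fun s hs => htC ⟨?_, ?_⟩⟩
  · simp only; linarith [hs.1]
  · simp only; linarith [hs.2]

theorem exists_mapsTo_Iic_truncatedCone [FiniteDimensional ℝ E] (h : IsConeField F ξ e κ r c)
    (hF : ContDiff ℝ 1 F) (hFc : HasCompactSupport F) :
    ∃ u : ℝ → E, (IsIntegralCurve u fun _ => F) ∧ inner ℝ e (u 0 - ξ) = r / 2 ∧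
      MapsTo u (Iic 0) (truncatedCone ξ e κ (r / 2)) := by
  obtain ⟨K, hK⟩ := hF.lipschitzWith_of_hasCompactSupport hFc one_ne_zero
  obtain ⟨φ, hφ0, hφ, hφc⟩ := exists_continuous_family_isIntegralCurve hF hFc
  -- the endpoints of the curves of length `n` form a decreasing sequence of compact sets
  let S : ℕ → Set E := fun n => {x | inner ℝ e (x - ξ) = r / 2} ∩
    ⋂ s ∈ Icc (-n : ℝ) 0, {x | φ x s ∈ truncatedCone ξ e κ (r / 2)}
  have hSclosed : ∀ n, IsClosed (S n) := fun n =>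
    (isClosed_eq (by fun_prop) continuous_const).inter
      (isClosed_biInter fun s _ => (isClosed_truncatedCone ξ e κ (r / 2)).preimage (hφc s))
  have hSne : ∀ n, (S n).Nonempty := fun n => by
    obtain ⟨u, hu, hu0, huC⟩ := h.exists_mapsTo_Icc_truncatedCone hK (fun x => ⟨φ x, hφ0 x, hφ x⟩) n
    have hφu : φ (u 0) = u := funext fun s => integralCurve_eqOn_of_eq hF ordConnected_univ
      ((hφ _).isIntegralCurveOn univ) (hu.isIntegralCurveOn univ) (mem_univ 0) (hφ0 _) (mem_univ s)
    refine ⟨u 0, hu0, mem_iInter₂.2 fun s hs => ?_⟩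
    rw [mem_ofPred_eq, hφu]
    exact huC hs
  have hScompact : IsCompact (S 0) := by
    refine (isCompact_closedBall ξ r).of_isClosed_subset (hSclosed 0) fun x hx => ?_
    have hx0 : φ x 0 ∈ truncatedCone ξ e κ (r / 2) := mem_iInter₂.1 hx.2 0 (by simp)
    rw [hφ0] at hx0
    exact Metric.ball_subset_closedBall (h.truncatedCone_subset_localCone hx0).1
  obtain ⟨x, hx⟩ := IsCompact.nonempty_iInter_of_sequence_nonempty_isCompact_isClosed S
    (fun n => inter_subset_inter_right _ (biInter_subset_biInter_left
      (Icc_subset_Icc_left (by push_cast; linarith)))) hSne hScompact hSclosed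
  rw [mem_iInter] at hx
  refine ⟨φ x, hφ x, by rw [hφ0]; exact (hx 0).1, fun s hs => ?_⟩
  obtain ⟨n, hn⟩ := exists_nat_ge (-s)
  exact mem_iInter₂.1 (hx n).2 s ⟨by linarith, hs⟩

theorem tendsto_atBot_of_mapsTo_truncatedCone (h : IsConeField F ξ e κ r c) {u : ℝ → E}
    (hu : IsIntegralCurveOn u (fun _ => F) (Iic 0))
    (huC : MapsTo u (Iic 0) (truncatedCone ξ e κ (r / 2))) : Tendsto u atBot (𝓝 ξ) := by
  have huL := huC.mono_right h.truncatedCone_subset_localCone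
  have hdecay : ∀ s < 0, ‖u s - ξ‖ ^ 2 ≤ r / c * (-s)⁻¹ := by
    intro s hs
    have hrate : 0 < c * (-s) := mul_pos h.drift_pos (neg_pos.2 hs)
    have hmono := h.inner_monotoneOn ordConnected_Iic hu huL
    have hgrowth := h.inner_add_mul_le (m := inner ℝ e (u s - ξ) ^ 2) hs.le
      (hu.mono Icc_subset_Iic_self) (huL.mono_left Icc_subset_Iic_self) fun t ht =>
        pow_le_pow_left₀ (huC hs.le).2.1 (hmono hs.le ht.2 ht.1) 2
    have hheight : inner ℝ e (u s - ξ) ^ 2 * (c * (-s)) ≤ r / 2 := by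
      linarith [(huC hs.le).2.1, (huC self_mem_Iic).2.2]
    rw [← div_eq_mul_inv, div_div, le_div_iff₀ hrate]
    nlinarith [h.norm_sq_le (huC hs.le).1]
  have hlim : Tendsto (fun s : ℝ => r / c * (-s)⁻¹) atBot (𝓝 0) := by
    simpa using (tendsto_inv_atTop_zero.comp tendsto_neg_atBot_atTop).const_mul (r / c)
  have hsq : Tendsto (fun s => ‖u s - ξ‖ ^ 2) atBot (𝓝 0) :=
    squeeze_zero' (Eventually.of_forall fun s => sq_nonneg _)
      ((eventually_lt_atBot 0).mono hdecay) hlim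
  rw [tendsto_iff_norm_sub_tendsto_zero]
  simpa [Function.comp_def, Real.sqrt_sq] using (Real.continuous_sqrt.tendsto 0).comp hsq

end IsConeField

/-- `v` is a solution of `v' = F v` on the interval `I`, unbounded below, which tends to `ξ` as
`s → -∞` and is not constantly `ξ`: a nontrivial curve in the unstable set of `ξ`. -/
structure IsIntegralCurveIssuingFrom (F : E → E) (ξ : E) (I : Set ℝ) (v : ℝ → E) : Prop where
  ordConnected : I.OrdConnected
  not_bddBelow : ¬BddBelow I
  isIntegralCurveOn : IsIntegralCurveOn v (fun _ => F) I
  tendsto : Tendsto v atBot (𝓝 ξ)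
  nontrivial : ∃ s ∈ I, v s ≠ ξ

namespace IsIntegralCurveIssuingFrom

variable {F : E → E} {ξ : E} {I : Set ℝ} {v : ℝ → E}

theorem Iic_subset (hv : IsIntegralCurveIssuingFrom F ξ I v) {s : ℝ} (hs : s ∈ I) : Iic s ⊆ I :=
  fun _ ht =>
    let ⟨_, hb, hbt⟩ := not_bddBelow_iff.1 hv.not_bddBelow _
    hv.ordConnected.out hb hs ⟨hbt.le, ht⟩

theorem ne_of_mem (hv : IsIntegralCurveIssuingFrom F ξ I v) (hF : ContDiff ℝ 1 F) (hξ : F ξ = 0)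
    {s : ℝ} (hs : s ∈ I) : v s ≠ ξ := fun hvs =>
  let ⟨_, ht, hvt⟩ := hv.nontrivial
  hvt (integralCurve_eqOn_of_eq hF hv.ordConnected hv.isIntegralCurveOn
    ((isIntegralCurve_const fun _ => hξ).isIntegralCurveOn I) hs hvs ht)

theorem exists_mapsTo_Iic_ball (hv : IsIntegralCurveIssuingFrom F ξ I v) {r : ℝ} (hr : 0 < r) :
    ∃ s ∈ I, MapsTo v (Iic s) (Metric.ball ξ r) := by
  obtain ⟨t, ht, -⟩ := hv.nontrivial
  obtain ⟨s, hs⟩ := eventually_atBot.1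
    ((hv.tendsto.eventually (Metric.ball_mem_nhds ξ hr)).and (eventually_le_atBot t))
  exact ⟨s, hv.Iic_subset ht (hs s le_rfl).2, fun s' hs' => (hs s' hs').1⟩

theorem tendsto_inner (hv : IsIntegralCurveIssuingFrom F ξ I v) (e : E) :
    Tendsto (fun s => inner ℝ e (v s - ξ)) atBot (𝓝 0) := by
  simpa using (tendsto_const_nhds (x := e)).inner (𝕜 := ℝ) (hv.tendsto.sub_const ξ)

theorem exists_le_inner_eq (hv : IsIntegralCurveIssuingFrom F ξ I v) (e : E) {s₀ m : ℝ}
    (hs₀ : s₀ ∈ I) (hm : 0 < m) (hms : m ≤ inner ℝ e (v s₀ - ξ)) :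
    ∃ s ≤ s₀, inner ℝ e (v s - ξ) = m := by
  obtain ⟨t, htm, hts⟩ :=
    (((hv.tendsto_inner e).eventually_lt_const hm).and (eventually_le_atBot s₀)).exists
  have hheight : ContinuousOn (fun s => inner ℝ e (v s - ξ)) (Icc t s₀) :=
    continuousOn_const.inner ((hv.isIntegralCurveOn.continuousOn.mono
      (Icc_subset_Iic_self.trans (hv.Iic_subset hs₀))).sub continuousOn_const)
  obtain ⟨s, hs, hsm⟩ := intermediate_value_Icc hts hheight ⟨htm.le, hms⟩
  exact ⟨s, hs.2, hsm⟩

end IsIntegralCurveIssuingFrom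

namespace IsConeField

variable {F : E → E} {ξ e : E} {κ r c : ℝ}

theorem inner_pos_of_issuingFrom (h : IsConeField F ξ e κ r c) (hF : ContDiff ℝ 1 F) {I : Set ℝ}
    {v : ℝ → E} (hv : IsIntegralCurveIssuingFrom F ξ I v) {s : ℝ} (hs : s ∈ I)
    (hvr : MapsTo v (Iic s) (Metric.ball ξ r)) : 0 < inner ℝ e (v s - ξ) := by
  have hode := hv.isIntegralCurveOn.mono (hv.Iic_subset hs)
  have hcone : MapsTo v (Iic s) (localCone ξ e κ r) := fun t ht =>
    have hsub := Iic_subset_Iic.2 ht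
    ⟨hvr ht, h.coneInner_sub_nonpos_of_tendsto (hode.mono hsub)
      ((isIntegralCurve_const fun _ => h.apply_eq_zero).isIntegralCurveOn _) (hvr.mono_left hsub)
      (fun _ _ => Metric.mem_ball_self h.radius_pos) hv.tendsto tendsto_const_nhds⟩
  have hnonneg : 0 ≤ inner ℝ e (v s - ξ) :=
    le_of_tendsto (hv.tendsto_inner e) ((eventually_le_atBot s).mono fun t ht =>
      h.inner_monotoneOn ordConnected_Iic hode hcone ht self_mem_Iic ht)
  refine hnonneg.lt_of_ne fun h0 => hv.ne_of_mem hF h.apply_eq_zero hs ?_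
  exact sub_eq_zero.1 (h.eq_zero_of_inner_eq_zero (hcone self_mem_Iic).2 h0.symm)

theorem exists_eq_translate (h : IsConeField F ξ e κ r c) (hF : ContDiff ℝ 1 F) {w : ℝ → E}
    (hw : IsIntegralCurveIssuingFrom F ξ univ w) {I : Set ℝ} {v : ℝ → E}
    (hv : IsIntegralCurveIssuingFrom F ξ I v) : ∃ a : ℝ, ∀ s ∈ I, v s = w (s + a) := by
  obtain ⟨sw, hsw, hwr⟩ := hw.exists_mapsTo_Iic_ball h.radius_pos
  obtain ⟨sv, hsv, hvr⟩ := hv.exists_mapsTo_Iic_ball h.radius_pos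
  have hm : 0 < min (inner ℝ e (w sw - ξ)) (inner ℝ e (v sv - ξ)) :=
    lt_min (h.inner_pos_of_issuingFrom hF hw hsw hwr) (h.inner_pos_of_issuingFrom hF hv hsv hvr)
  obtain ⟨tw, htw, hwm⟩ := hw.exists_le_inner_eq e hsw hm (min_le_left _ _)
  obtain ⟨tv, htv, hvm⟩ := hv.exists_le_inner_eq e hsv hm (min_le_right _ _)
  have htvI : tv ∈ I := hv.Iic_subset hsv htv
  have hshift : IsIntegralCurve (fun s => w (s + (tw - tv))) fun _ => F :=
    (isIntegralCurveOn_univ.1 hw.isIntegralCurveOn).comp_add _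
  have hcone := h.coneInner_sub_nonpos_of_tendsto (s₀ := tv)
    (hv.isIntegralCurveOn.mono (hv.Iic_subset htvI)) (hshift.isIntegralCurveOn _)
    (hvr.mono_left (Iic_subset_Iic.2 htv))
    (fun s hs => hwr (by simp only [mem_Iic] at hs ⊢; linarith))
    hv.tendsto (hw.tendsto.comp (tendsto_atBot_add_const_right _ _ tendsto_id))
  have hmeet : v tv - w (tv + (tw - tv)) = 0 := by
    refine h.eq_zero_of_inner_eq_zero hcone ?_
    rw [add_sub_cancel, ← sub_sub_sub_cancel_right _ _ ξ, inner_sub_right, hvm, hwm, sub_self]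
  exact ⟨tw - tv, integralCurve_eqOn_of_eq hF hv.ordConnected hv.isIntegralCurveOn
    (hshift.isIntegralCurveOn I) htvI (sub_eq_zero.1 hmeet)⟩

theorem exists_issuingFrom_univ [FiniteDimensional ℝ E] (h : IsConeField F ξ e κ r c)
    (hF : ContDiff ℝ 1 F) (hinward : ∀ᶠ x in Bornology.cobounded E, inner ℝ x (F x) ≤ 0) :
    ∃ w : ℝ → E, IsIntegralCurveIssuingFrom F ξ univ w := by
  obtain ⟨R, -, hR⟩ := Filter.hasBasis_cobounded_norm.eventually_iff.1 hinward
  obtain ⟨S, hS, hRS, hball⟩ : ∃ S > 0, R ≤ S ∧ Metric.ball ξ r ⊆ Metric.closedBall 0 S := by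
    refine ⟨max R (‖ξ‖ + r), lt_max_of_lt_right (add_pos_of_nonneg_of_pos (norm_nonneg _)
      h.radius_pos), le_max_left _ _, Metric.ball_subset_closedBall.trans
      (Metric.closedBall_subset_closedBall' ?_)⟩
    rw [dist_zero_right, add_comm]
    exact le_max_right _ _
  obtain ⟨G, hG, hGc, hFG, hGF⟩ :=
    exists_contDiff_hasCompactSupport_eqOn_closedBall (n := 1) hF hS
  obtain ⟨w, hw, hw0, hwC⟩ :=
    (h.congr (hFG.mono hball)).exists_mapsTo_Iic_truncatedCone hG hGc
  have hwball : MapsTo w (Iic 0) (Metric.closedBall 0 S) := fun s hs =>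
    hball (h.truncatedCone_subset_localCone (hwC hs)).1
  have hwS : ∀ s, w s ∈ Metric.closedBall 0 S := fun s => by
    rcases le_total s 0 with hs | hs
    · exact hwball hs
    refine mem_closedBall_zero_iff.2 (norm_le_of_forall_inner_nonpos hS.le (fun x hx => ?_) hs
      (hw.isIntegralCurveOn _) (mem_closedBall_zero_iff.1 (hwball self_mem_Iic)))
    obtain ⟨a, ha, hax⟩ := hGF x
    rw [hax, inner_smul_right]
    exact mul_nonpos_of_nonneg_of_nonpos ha (hR (hRS.trans hx))
  have hwF : IsIntegralCurve w fun _ => F := fun s => by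
    simpa only [hFG (hwS s)] using hw s
  refine ⟨w, ordConnected_univ, not_bddBelow_univ, hwF.isIntegralCurveOn univ,
    h.tendsto_atBot_of_mapsTo_truncatedCone (hwF.isIntegralCurveOn _) hwC, 0, mem_univ 0, ?_⟩
  rintro hw0ξ
  rw [hw0ξ, sub_self, inner_zero_right] at hw0
  exact (half_pos h.radius_pos).ne hw0

end IsConeField

end ConeFields

section SecondOrderTaylor

variable {E G : Type*} [NormedAddCommGroup E] [NormedSpace ℝ E] [NormedAddCommGroup G]
  [NormedSpace ℝ G]

theorem isLittleO_sub_taylor_two {f : E → G} {x : E} (hf : ContDiffAt ℝ 2 f x) :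
    (fun y => f y - f x - fderiv ℝ f x (y - x) -
      (2⁻¹ : ℝ) • fderiv ℝ (fderiv ℝ f) x (y - x) (y - x)) =o[𝓝 x] fun y => ‖y - x‖ ^ 2 := by
  set A := fderiv ℝ f x
  set B := fderiv ℝ (fderiv ℝ f) x
  have hsymm : ∀ u v, B u v = B v u := (hf.isSymmSndFDerivAt (by simp)).eq
  have hdiff : ∀ᶠ y in 𝓝 x, DifferentiableAt ℝ f y :=
    (hf.eventually (by simp)).mono fun y hy => hy.differentiableAt two_ne_zero
  obtain ⟨ε, hε, hball⟩ := Metric.eventually_nhds_iff_ball.1 hdiff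
  have hderiv : ∀ y ∈ Metric.ball x ε,
      HasFDerivAt (fun y => f y - A (y - x) - (2⁻¹ : ℝ) • B (y - x) (y - x))
        (fderiv ℝ f y - A - B (y - x)) y := fun y hy => by
    have hid : HasFDerivAt (fun y => y - x) (ContinuousLinearMap.id ℝ E) y :=
      (hasFDerivAt_id y).sub_const x
    refine (((hball y hy).hasFDerivAt.sub (A.hasFDerivAt.comp y hid)).sub
      ((B.hasFDerivAt_of_bilinear hid hid).const_smul (2⁻¹ : ℝ))).congr_fderiv ?_
    ext u
    simp [hsymm u, ← add_smul, ← two_mul]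
  have hB : HasFDerivAt (fderiv ℝ f) B x :=
    ((hf.fderiv_right (m := 1) le_rfl).differentiableAt one_ne_zero).hasFDerivAt
  have hderiv_isLittleO : (fun y => fderiv ℝ f y - A - B (y - x)) =o[𝓝 x] fun y => ‖y - x‖ ^ 1 := by
    simpa using hB.isLittleO.norm_right
  have hx : x ∈ Metric.ball x ε := Metric.mem_ball_self hε
  have := (convex_ball x ε).isLittleO_pow_succ hx (fun y hy => (hderiv y hy).hasFDerivWithinAt)
    (hderiv_isLittleO.mono nhdsWithin_le_nhds)
  rw [nhdsWithin_eq_nhds.2 (Metric.ball_mem_nhds x hε)] at this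
  refine this.congr_left fun y => ?_
  simp only [sub_self, map_zero, smul_zero, sub_zero]
  abel

end SecondOrderTaylor

section SaddleNodes

variable {E : Type*} [NormedAddCommGroup E] [InnerProductSpace ℝ E] {F : E → E} {ξ e l : E}
  {κ μ : ℝ}

/-- `F` is `C²` at its zero `ξ`, its derivative there annihilates `l` and is negative definite
transversally to `l`, and its second derivative is nondegenerate along `l`. This is the normal form
condition for a saddle-node whose other eigenvalues are stable; the derivative of `F` need not be
symmetric. -/
structure IsSaddleNode (F : E → E) (ξ l : E) : Prop where
  contDiffAt : ContDiffAt ℝ 2 F ξ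
  apply_eq_zero : F ξ = 0
  fderiv_apply_eq_zero : fderiv ℝ F ξ l = 0
  inner_fderiv_neg : ∀ u ∉ Submodule.span ℝ {l}, inner ℝ u (fderiv ℝ F ξ u) < 0
  inner_fderiv_fderiv_ne_zero : inner ℝ l (fderiv ℝ (fderiv ℝ F) ξ l l) ≠ 0

theorem norm_sub_inner_smul_sq (he : ‖e‖ = 1) (v : E) :
    ‖v - inner ℝ e v • e‖ ^ 2 = ‖v‖ ^ 2 - inner ℝ e v ^ 2 := by
  rw [norm_sub_sq_real, inner_smul_right, norm_smul, he, real_inner_comm, Real.norm_eq_abs,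
    mul_one, sq_abs]
  ring

theorem abs_coneInner_le (he : ‖e‖ = 1) (hκ : κ ∈ Icc 0 2) (u v : E) :
    |coneInner e κ u v| ≤ 3 * (‖u‖ * ‖v‖) := by
  have abs_inner_le : ∀ w, |inner ℝ e w| ≤ ‖w‖ := fun w => by
    simpa [he] using abs_real_inner_le_norm e w
  calc |coneInner e κ u v| ≤ |inner ℝ u v| + |κ * (inner ℝ e u * inner ℝ e v)| := abs_sub _ _
    _ = |inner ℝ u v| + κ * (|inner ℝ e u| * |inner ℝ e v|) := by
      rw [abs_mul, abs_mul, abs_of_nonneg hκ.1]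
    _ ≤ ‖u‖ * ‖v‖ + 2 * (‖u‖ * ‖v‖) := by
      gcongr
      exacts [abs_real_inner_le_norm u v, hκ.2, abs_inner_le u, abs_inner_le v]
    _ = 3 * (‖u‖ * ‖v‖) := by ring

theorem exists_ball_coneInner_sub_nonpos {A : E →L[ℝ] E} (hF : HasStrictFDerivAt F A ξ)
    (he : ‖e‖ = 1) (hμ : 0 < μ) (hA : ∀ u, inner ℝ u (A u) ≤ -μ * (‖u‖ ^ 2 - inner ℝ e u ^ 2))
    (heA : ∀ u, inner ℝ e (A u) = 0) (hκ : κ ∈ Ioc 1 2) :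
    ∃ r > 0, ∀ x ∈ Metric.ball ξ r, ∀ y ∈ Metric.ball ξ r, 0 < coneInner e κ (x - y) (x - y) →
      coneInner e κ (x - y) (F x - F y) ≤ 0 := by
  have hδ : 0 < μ * (κ - 1) / 6 := by have := sub_pos.2 hκ.1; positivity
  obtain ⟨r, hr, hball⟩ := Metric.eventually_nhds_iff_ball.1 (hF.isLittleO.def hδ)
  refine ⟨r, hr, fun x hx y hy hpos => ?_⟩
  have hremainder : ‖F x - F y - A (x - y)‖ ≤ μ * (κ - 1) / 6 * ‖x - y‖ :=
    hball (x, y) (by rw [← ball_prod_same]; exact ⟨hx, hy⟩)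
  set u := x - y
  set ρ := F x - F y - A u
  have htransverse : (κ - 1) / 2 * ‖u‖ ^ 2 ≤ ‖u‖ ^ 2 - inner ℝ e u ^ 2 := by
    rw [coneInner, real_inner_self_eq_norm_sq] at hpos
    nlinarith [hκ.1, hκ.2, sq_nonneg (inner ℝ e u),
      mul_nonneg (sub_nonneg.2 hκ.1.le) (sub_nonneg.2 hκ.2)]
  have hlinear : coneInner e κ u (A u) ≤ -(μ * (κ - 1) / 2) * ‖u‖ ^ 2 := by
    rw [coneInner, heA, mul_zero, mul_zero, sub_zero]
    linarith [hA u, mul_le_mul_of_nonneg_left htransverse hμ.le]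
  calc coneInner e κ u (F x - F y) = coneInner e κ u (A u) + coneInner e κ u ρ := by
        simp only [coneInner, ρ, inner_sub_right]
        ring
    _ ≤ -(μ * (κ - 1) / 2) * ‖u‖ ^ 2 + 3 * (‖u‖ * (μ * (κ - 1) / 6 * ‖u‖)) := by
        gcongr
        exact (le_abs_self _).trans ((abs_coneInner_le he ⟨by linarith [hκ.1], hκ.2⟩ u ρ).trans
          (by gcongr))
    _ = 0 := by ring

theorem half_mul_inner_sq_le_of_coneInner_nonpos (he : ‖e‖ = 1) {B : E →L[ℝ] E →L[ℝ] ℝ} {M : ℝ}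
    (hM : M ∈ Icc 0 1) (hMB : 6 * M * ‖B‖ ≤ B e e) {v : E} (hv : coneInner e (1 + M ^ 2) v v ≤ 0) :
    B e e / 2 * inner ℝ e v ^ 2 ≤ B v v := by
  set y := inner ℝ e v
  set z := v - y • e with hz
  have hvnorm : ‖v‖ ^ 2 ≤ (1 + M ^ 2) * y ^ 2 := by
    rw [coneInner, real_inner_self_eq_norm_sq] at hv
    linarith
  have hzy : ‖z‖ ≤ M * |y| := by
    refine le_of_sq_le_sq ?_ (mul_nonneg hM.1 (abs_nonneg y))
    rw [norm_sub_inner_smul_sq he, mul_pow, sq_abs]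
    linarith
  have hvy : ‖v‖ ≤ 2 * |y| := by
    refine le_of_sq_le_sq ?_ (by positivity)
    rw [mul_pow, sq_abs]
    nlinarith [hM.1, hM.2, sq_nonneg y, pow_le_one₀ (n := 2) hM.1 hM.2]
  have hsplit : B v v = y ^ 2 * B e e + (B z v + y * B e z) := by
    simp only [hz, map_sub, map_smul, sub_apply, smul_apply, smul_eq_mul]
    ring
  have hcross : |B z v + y * B e z| ≤ 3 * M * ‖B‖ * y ^ 2 :=
    calc |B z v + y * B e z| ≤ |B z v| + |y| * |B e z| := by
          rw [← abs_mul]; exact abs_add_le _ _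
      _ ≤ ‖B‖ * ‖z‖ * ‖v‖ + |y| * (‖B‖ * ‖e‖ * ‖z‖) := by
          gcongr
          exacts [B.le_opNorm₂ z v, B.le_opNorm₂ e z]
      _ ≤ ‖B‖ * (M * |y|) * (2 * |y|) + |y| * (‖B‖ * 1 * (M * |y|)) := by
          have := (norm_nonneg z).trans hzy
          rw [he]
          gcongr
      _ = 3 * M * ‖B‖ * y ^ 2 := by rw [← sq_abs y]; ring
  rw [hsplit]
  linarith [neg_le_of_abs_le hcross, mul_le_mul_of_nonneg_right hMB (sq_nonneg y)]

theorem exists_forall_half_mul_inner_sq_le (he : ‖e‖ = 1) {B : E →L[ℝ] E →L[ℝ] ℝ}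
    (hB : 0 < B e e) : ∃ κ ∈ Ioc (1 : ℝ) 2, ∀ v, coneInner e κ v v ≤ 0 →
      B e e / 2 * inner ℝ e v ^ 2 ≤ B v v := by
  set M := min 1 (B e e / (6 * (‖B‖ + 1)))
  have hMpos : 0 < M := by positivity
  have hMle : M ≤ 1 := min_le_left _ _
  have hMB : M * (6 * (‖B‖ + 1)) ≤ B e e := by
    rw [← le_div_iff₀ (by positivity)]; exact min_le_right _ _
  refine ⟨1 + M ^ 2,
    ⟨by linarith [pow_pos hMpos 2], by linarith [pow_le_one₀ (n := 2) hMpos.le hMle]⟩,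
    fun v hv => half_mul_inner_sq_le_of_coneInner_nonpos he ⟨hMpos.le, hMle⟩ ?_ hv⟩
  linarith

theorem exists_forall_mem_localCone_mul_inner_sq_le (he : ‖e‖ = 1) (hF : ContDiffAt ℝ 2 F ξ)
    (hF0 : F ξ = 0) (heA : ∀ u, inner ℝ e (fderiv ℝ F ξ u) = 0)
    (hB : 0 < inner ℝ e (fderiv ℝ (fderiv ℝ F) ξ e e)) :
    ∃ κ ∈ Ioc (1 : ℝ) 2, ∃ r > 0, ∃ c > 0, ∀ x ∈ localCone ξ e κ r,
      c * inner ℝ e (x - ξ) ^ 2 ≤ inner ℝ e (F x) := by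
  set B := fderiv ℝ (fderiv ℝ F) ξ
  set b := inner ℝ e (B e e)
  obtain ⟨κ, hκ, hcone⟩ := exists_forall_half_mul_inner_sq_le he
    (B := (ContinuousLinearMap.compL ℝ E E ℝ (innerSL ℝ e)).comp B) hB
  obtain ⟨r, hr, htaylor⟩ := Metric.eventually_nhds_iff_ball.1
    ((isLittleO_sub_taylor_two hF).def (show 0 < b / 16 by positivity))
  refine ⟨κ, hκ, r, hr, b / 8, by positivity, fun x hx => ?_⟩
  have hquadratic : b / 2 * inner ℝ e (x - ξ) ^ 2 ≤ inner ℝ e (B (x - ξ) (x - ξ)) :=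
    hcone (x - ξ) hx.2
  have hnorm : ‖x - ξ‖ ^ 2 ≤ 2 * inner ℝ e (x - ξ) ^ 2 := by
    have := hx.2
    rw [coneInner, real_inner_self_eq_norm_sq] at this
    nlinarith [hκ.2, sq_nonneg (inner ℝ e (x - ξ))]
  have hremainder : |inner ℝ e (F x) - 2⁻¹ * inner ℝ e (B (x - ξ) (x - ξ))| ≤
      b / 16 * ‖x - ξ‖ ^ 2 := by
    have := (abs_real_inner_le_norm e _).trans
      (mul_le_mul_of_nonneg_left (htaylor x hx.1) (norm_nonneg e))
    simpa [he, hF0, heA, inner_sub_right, inner_smul_right] using this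
  linarith [neg_le_of_abs_le hremainder,
    mul_le_mul_of_nonneg_left hnorm (show 0 ≤ b / 16 by positivity)]

namespace IsSaddleNode

theorem smul (h : IsSaddleNode F ξ l) {a : ℝ} (ha : a ≠ 0) : IsSaddleNode F ξ (a • l) where
  contDiffAt := h.contDiffAt
  apply_eq_zero := h.apply_eq_zero
  fderiv_apply_eq_zero := by rw [map_smul, h.fderiv_apply_eq_zero, smul_zero]
  inner_fderiv_neg := by
    rw [Submodule.span_singleton_smul_eq (IsUnit.mk0 a ha)]
    exact h.inner_fderiv_neg
  inner_fderiv_fderiv_ne_zero := by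
    simpa [inner_smul_left, inner_smul_right, ha] using h.inner_fderiv_fderiv_ne_zero

theorem exists_norm_eq_one_pos (h : IsSaddleNode F ξ l) :
    ∃ e, ‖e‖ = 1 ∧ IsSaddleNode F ξ e ∧ 0 < inner ℝ e (fderiv ℝ (fderiv ℝ F) ξ e e) := by
  have hl : l ≠ 0 := by
    rintro rfl
    simpa using h.inner_fderiv_fderiv_ne_zero
  have hunit : ‖‖l‖⁻¹ • l‖ = 1 := by simp [norm_smul, hl]
  have hnode := h.smul (inv_ne_zero (norm_ne_zero_iff.2 hl))
  set e := ‖l‖⁻¹ • l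
  rcases hnode.inner_fderiv_fderiv_ne_zero.lt_or_gt with hneg | hpos
  · refine ⟨-e, by rw [norm_neg, hunit], ?_, by simpa using hneg⟩
    simpa using hnode.smul (neg_ne_zero.2 one_ne_zero)
  · exact ⟨e, hunit, hnode, hpos⟩

theorem inner_fderiv_nonpos (h : IsSaddleNode F ξ l) (u : E) :
    inner ℝ u (fderiv ℝ F ξ u) ≤ 0 := by
  by_cases hu : u ∈ Submodule.span ℝ {l}
  · obtain ⟨a, rfl⟩ := Submodule.mem_span_singleton.1 hu
    simp [h.fderiv_apply_eq_zero]
  · exact (h.inner_fderiv_neg u hu).le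

theorem inner_fderiv_eq_zero (h : IsSaddleNode F ξ l) (u : E) :
    inner ℝ l (fderiv ℝ F ξ u) = 0 := by
  -- the quadratic form at `u + t l` is affine in `t` and bounded above
  have haffine : ∀ t : ℝ, inner ℝ u (fderiv ℝ F ξ u) + t * inner ℝ l (fderiv ℝ F ξ u) ≤ 0 :=
    fun t => by
      simpa [h.fderiv_apply_eq_zero, inner_add_left, inner_smul_left] using
        h.inner_fderiv_nonpos (u + t • l)
  by_contra hne
  have := haffine ((1 - inner ℝ u (fderiv ℝ F ξ u)) / inner ℝ l (fderiv ℝ F ξ u))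
  rw [div_mul_cancel₀ _ hne] at this
  linarith

theorem exists_pos_inner_fderiv_le [FiniteDimensional ℝ E] (h : IsSaddleNode F ξ e)
    (he : ‖e‖ = 1) :
    ∃ μ > 0, ∀ u, inner ℝ u (fderiv ℝ F ξ u) ≤ -μ * (‖u‖ ^ 2 - inner ℝ e u ^ 2) := by
  set A := fderiv ℝ F ξ
  obtain ⟨μ, hμ, hsphere⟩ : ∃ μ > 0, ∀ z, ‖z‖ = 1 → inner ℝ e z = 0 → inner ℝ z (A z) ≤ -μ := by
    have hcompact : IsCompact (Metric.sphere (0 : E) 1 ∩ {z | inner ℝ e z = 0}) :=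
      (isCompact_sphere 0 1).inter_right (isClosed_eq (by fun_prop) continuous_const)
    have hneg : ∀ z ∈ Metric.sphere (0 : E) 1 ∩ {z | inner ℝ e z = 0}, 0 < -inner ℝ z (A z) := by
      rintro z ⟨hz, hez : inner ℝ e z = 0⟩
      refine neg_pos.2 (h.inner_fderiv_neg z fun hmem => ?_)
      obtain ⟨a, rfl⟩ := Submodule.mem_span_singleton.1 hmem
      simp_all [inner_smul_right]
    obtain ⟨μ, hμ, hle⟩ := hcompact.exists_forall_le' (f := fun z => -inner ℝ z (A z))
      (by fun_prop) hneg
    exact ⟨μ, hμ, fun z hz hez => le_neg_of_le_neg (hle z ⟨by simpa using hz, hez⟩)⟩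
  have hperp : ∀ z, inner ℝ e z = 0 → inner ℝ z (A z) ≤ -μ * ‖z‖ ^ 2 := fun z hez => by
    rcases eq_or_ne z 0 with rfl | hz
    · simp
    have hunit := hsphere (‖z‖⁻¹ • z) (by simp [norm_smul, hz])
      (by rw [inner_smul_right, hez, mul_zero])
    rw [map_smul, real_inner_smul_left, real_inner_smul_right, ← mul_assoc, ← mul_inv, ← sq,
      inv_mul_le_iff₀ (by positivity)] at hunit
    linarith
  refine ⟨μ, hμ, fun u => ?_⟩
  set z := u - inner ℝ e u • e
  have hez : inner ℝ e z = 0 := by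
    simp [z, inner_sub_right, inner_smul_right, he]
  have hAz : inner ℝ z (A z) = inner ℝ u (A u) := by
    simp [z, A, inner_sub_left, inner_smul_left, h.fderiv_apply_eq_zero, h.inner_fderiv_eq_zero]
  rw [← norm_sub_inner_smul_sq he, ← hAz]
  exact hperp z hez

theorem exists_isConeField [FiniteDimensional ℝ E] (h : IsSaddleNode F ξ l) :
    ∃ e κ r c, IsConeField F ξ e κ r c := by
  obtain ⟨e, he, h, hpos⟩ := h.exists_norm_eq_one_pos
  obtain ⟨μ, hμ, hμle⟩ := h.exists_pos_inner_fderiv_le he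
  obtain ⟨κ, hκ, r₁, hr₁, c, hc, hdrift⟩ := exists_forall_mem_localCone_mul_inner_sq_le he
    h.contDiffAt h.apply_eq_zero h.inner_fderiv_eq_zero hpos
  obtain ⟨r₂, hr₂, hcontract⟩ := exists_ball_coneInner_sub_nonpos
    (h.contDiffAt.hasStrictFDerivAt two_ne_zero) he hμ hμle h.inner_fderiv_eq_zero hκ
  have hball₁ : Metric.ball ξ (min r₁ r₂) ⊆ Metric.ball ξ r₁ :=
    Metric.ball_subset_ball (min_le_left _ _)
  have hball₂ : Metric.ball ξ (min r₁ r₂) ⊆ Metric.ball ξ r₂ :=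
    Metric.ball_subset_ball (min_le_right _ _)
  exact ⟨e, κ, min r₁ r₂, c,
    { norm_eq_one := he
      one_le := hκ.1.le
      le_two := hκ.2
      radius_pos := lt_min hr₁ hr₂
      drift_pos := hc
      apply_eq_zero := h.apply_eq_zero
      contract := fun x hx y hy => hcontract x (hball₂ hx) y (hball₂ hy)
      drift := fun x hx => hdrift x ⟨hball₁ hx.1, hx.2⟩ }⟩

end IsSaddleNode

theorem mainTheorem2_general [FiniteDimensional ℝ E] (h : IsSaddleNode F ξ l)
    (hF : ContDiff ℝ 1 F) (hinward : ∀ᶠ x in Bornology.cobounded E, inner ℝ x (F x) ≤ 0) :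
    ∃ w, IsIntegralCurveIssuingFrom F ξ univ w ∧
      ∀ I v, IsIntegralCurveIssuingFrom F ξ I v → ∃ c, ∀ s ∈ I, v s = w (s + c) := by
  obtain ⟨e, κ, r, c, hcone⟩ := h.exists_isConeField
  obtain ⟨w, hw⟩ := hcone.exists_issuingFrom_univ hF hinward
  exact ⟨w, hw, fun I v hv => hcone.exists_eq_translate hF hw hv⟩

end SaddleNodes

section GradientFields

variable {n : ℕ} {g : EuclideanSpace ℝ (Fin n) → ℝ}

theorem fderiv_apply_eq_sum_partialD (g : EuclideanSpace ℝ (Fin n) → ℝ)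
    (x u : EuclideanSpace ℝ (Fin n)) : fderiv ℝ g x u = ∑ i, u i * partialD i g x := by
  have hu : u = ∑ i, u i • EuclideanSpace.single i (1 : ℝ) := by
    ext j
    simp [Pi.single_apply]
  conv_lhs => rw [hu]
  simp [partialD]

theorem contDiff_partialD {k : WithTop ℕ∞} (hg : ContDiff ℝ (k + 1) g) (i : Fin n) :
    ContDiff ℝ k (partialD i g) :=
  (hg.fderiv_right le_rfl).clm_apply contDiff_const

theorem gradient_apply (g : EuclideanSpace ℝ (Fin n) → ℝ) (x : EuclideanSpace ℝ (Fin n))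
    (i : Fin n) : gradient g x i = partialD i g x := by
  rw [partialD, ← inner_gradient_left, EuclideanSpace.inner_single_right, one_mul, conj_trivial]

theorem contDiff_gradient {k : WithTop ℕ∞} (hg : ContDiff ℝ (k + 1) g) :
    ContDiff ℝ k (gradient g) :=
  (InnerProductSpace.toDual ℝ (EuclideanSpace ℝ (Fin n))).symm.contDiff.comp
    (hg.fderiv_right le_rfl)

theorem fderiv_euclidean_apply {E : Type*} [NormedAddCommGroup E] [NormedSpace ℝ E]
    {Φ : E → EuclideanSpace ℝ (Fin n)} {x : E} (hΦ : DifferentiableAt ℝ Φ x) (u : E) (i : Fin n) :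
    fderiv ℝ Φ x u i = fderiv ℝ (fun y => Φ y i) x u := by
  have hcoord : HasFDerivAt (fun y => Φ y i) ((EuclideanSpace.proj i).comp (fderiv ℝ Φ x)) x :=
    (EuclideanSpace.proj (𝕜 := ℝ) i).hasFDerivAt.comp x hΦ.hasFDerivAt
  rw [hcoord.fderiv]
  rfl

theorem fderiv_gradient_apply (hg : ContDiff ℝ 2 g) (x u : EuclideanSpace ℝ (Fin n)) (i : Fin n) :
    fderiv ℝ (gradient g) x u i = fderiv ℝ (partialD i g) x u := by
  rw [fderiv_euclidean_apply ((contDiff_gradient (k := 1) hg).differentiable one_ne_zero x)]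
  simp only [gradient_apply]

theorem fderiv_gradient_eq_toEuclideanLin (hg : ContDiff ℝ 2 g)
    (x u : EuclideanSpace ℝ (Fin n)) :
    fderiv ℝ (gradient g) x u = Matrix.toEuclideanLin (hessianMatrix g x).transpose u := by
  ext i
  rw [fderiv_gradient_apply hg, fderiv_apply_eq_sum_partialD]
  simp [Matrix.toLpLin_apply, Matrix.mulVec, dotProduct, hessianMatrix, mul_comm]

theorem fderiv_fderiv_apply {E G : Type*} [NormedAddCommGroup E] [NormedSpace ℝ E]
    [NormedAddCommGroup G] [NormedSpace ℝ G] {f : E → G} (hf : ContDiff ℝ 2 f) (x u v : E) :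
    fderiv ℝ (fderiv ℝ f) x u v = fderiv ℝ (fun y => fderiv ℝ f y v) x u := by
  rw [fderiv_clm_apply ((hf.fderiv_right (m := 1) le_rfl).differentiable one_ne_zero x)
    (differentiableAt_const v)]
  simp

theorem fderiv_fderiv_gradient_apply (hg : ContDiff ℝ 3 g) (x u v : EuclideanSpace ℝ (Fin n))
    (i : Fin n) :
    fderiv ℝ (fderiv ℝ (gradient g)) x u v i = fderiv ℝ (fderiv ℝ (partialD i g)) x u v := by
  have hgradient : ContDiff ℝ 2 (gradient g) := contDiff_gradient (k := 2) hg
  have hdiff : Differentiable ℝ fun y => fderiv ℝ (gradient g) y v :=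
    ((hgradient.fderiv_right (m := 1) le_rfl).clm_apply contDiff_const).differentiable one_ne_zero
  rw [fderiv_fderiv_apply hgradient, fderiv_euclidean_apply (hdiff x),
    fderiv_fderiv_apply (contDiff_partialD (k := 2) hg i)]
  simp only [fderiv_gradient_apply (hg.of_le (by norm_num))]

theorem fderiv_fderiv_apply_eq_sum_hessianMatrix (hg : ContDiff ℝ 2 g)
    (x u v : EuclideanSpace ℝ (Fin n)) :
    fderiv ℝ (fderiv ℝ g) x u v = ∑ i, ∑ j, u i * v j * hessianMatrix g x i j := by
  have hdiff : ∀ j, DifferentiableAt ℝ (partialD j g) x := fun j =>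
    (contDiff_partialD (k := 1) hg j).differentiable one_ne_zero x
  simp only [fderiv_fderiv_apply hg, fderiv_apply_eq_sum_partialD g]
  rw [fderiv_fun_sum fun j _ => (hdiff j).const_mul (v j)]
  simp only [fun j => fderiv_const_mul (hdiff j) (v j), sum_apply, smul_apply, smul_eq_mul,
    fderiv_apply_eq_sum_partialD _ x u, Finset.mul_sum]
  rw [Finset.sum_comm]
  refine Finset.sum_congr rfl fun i _ => Finset.sum_congr rfl fun j _ => ?_
  rw [hessianMatrix, Matrix.of_apply]
  ring

theorem inner_fderiv_fderiv_gradient (hg : ContDiff ℝ 3 g) (x u : EuclideanSpace ℝ (Fin n)) :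
    inner ℝ u (fderiv ℝ (fderiv ℝ (gradient g)) x u u) = cubicTerm g x u := by
  have hexpand : inner ℝ u (fderiv ℝ (fderiv ℝ (gradient g)) x u u) =
      ∑ k, ∑ i, ∑ j, partialD i (partialD j (partialD k g)) x * u i * u j * u k := by
    simp only [PiLp.inner_apply, RCLike.inner_apply, conj_trivial, fderiv_fderiv_gradient_apply hg,
      fun k => fderiv_fderiv_apply_eq_sum_hessianMatrix (contDiff_partialD (k := 2) hg k) x u u,
      hessianMatrix, Matrix.of_apply, Finset.sum_mul]
    refine Finset.sum_congr rfl fun k _ => Finset.sum_congr rfl fun i _ =>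
      Finset.sum_congr rfl fun j _ => ?_
    ring
  rw [hexpand, Finset.sum_comm]
  exact Finset.sum_congr rfl fun i _ => Finset.sum_comm

theorem isSaddleNode_neg_gradient {ξ l : EuclideanSpace ℝ (Fin n)} (hg : ContDiff ℝ 3 g)
    (hcrit : gradient g ξ = 0) (hpos : (hessianMatrix g ξ).PosSemidef)
    (hker : LinearMap.ker (Matrix.toEuclideanLin (hessianMatrix g ξ)) = Submodule.span ℝ {l})
    (hcubic : cubicTerm g ξ l ≠ 0) : IsSaddleNode (fun x => -gradient g x) ξ l := by
  have hderiv : fderiv ℝ (fun x => -gradient g x) = fun x => -fderiv ℝ (gradient g) x :=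
    funext fun x => fderiv_fun_neg
  have hhessian : ∀ u,
      fderiv ℝ (gradient g) ξ u = Matrix.toEuclideanLin (hessianMatrix g ξ) u := fun u => by
    rw [fderiv_gradient_eq_toEuclideanLin (hg.of_le (by norm_num)),
      ← Matrix.conjTranspose_eq_transpose_of_trivial, hpos.isHermitian.eq]
  refine ⟨(contDiff_gradient (k := 2) hg).neg.contDiffAt, by rw [hcrit, neg_zero], ?_,
    fun u hu => ?_, ?_⟩
  · have : l ∈ LinearMap.ker (Matrix.toEuclideanLin (hessianMatrix g ξ)) :=
      hker ▸ Submodule.mem_span_singleton_self l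
    rw [hderiv, neg_apply, hhessian, LinearMap.mem_ker.1 this, neg_zero]
  · have hform : inner ℝ u (Matrix.toEuclideanLin (hessianMatrix g ξ) u) =
        star u.ofLp ⬝ᵥ (hessianMatrix g ξ).mulVec u.ofLp := by
      rw [Matrix.toLpLin_apply, EuclideanSpace.inner_eq_star_dotProduct, dotProduct_comm]
    rw [hderiv, neg_apply, inner_neg_right, hhessian, neg_lt_zero, hform]
    refine (hpos.dotProduct_mulVec_nonneg _).lt_of_ne' fun h0 => hu ?_
    rw [hpos.dotProduct_mulVec_zero_iff] at h0
    rw [← hker, LinearMap.mem_ker, Matrix.toLpLin_apply, h0, WithLp.toLp_zero]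
  · rw [hderiv, fderiv_fun_neg, neg_apply, neg_apply, inner_neg_right,
      inner_fderiv_fderiv_gradient hg]
    exact neg_ne_zero.2 hcubic

theorem isSolutionIssuingFrom_iff {ξ : EuclideanSpace ℝ (Fin n)} {I : Set ℝ}
    {w : ℝ → EuclideanSpace ℝ (Fin n)} : IsSolutionIssuingFrom g ξ I w ↔
      IsIntegralCurveIssuingFrom (fun x => -gradient g x) ξ I w :=
  ⟨fun h => ⟨h.ordConnected, h.not_bddBelow, h.ode, h.tendsto, h.nontrivial⟩,
    fun h => ⟨h.ordConnected, h.not_bddBelow, h.isIntegralCurveOn, h.tendsto, h.nontrivial⟩⟩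

end GradientFields

namespace IsCoerciveC3

variable {n : ℕ} {T τ : ℝ} {f : ℝ → EuclideanSpace ℝ (Fin n) → ℝ}

theorem contDiff (hf : IsCoerciveC3 T f) (hτ : τ ∈ Icc 0 T) : ContDiff ℝ 3 (f τ) := by
  rw [← contDiffOn_univ]
  exact hf.1.comp (contDiff_prodMk_right τ).contDiffOn fun x _ => ⟨hτ, mem_univ x⟩

theorem eventually_inner_neg_gradient_nonpos (hf : IsCoerciveC3 T f) (hτ : τ ∈ Icc 0 T) :
    ∀ᶠ x in Bornology.cobounded (EuclideanSpace ℝ (Fin n)),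
      inner ℝ x (-gradient (f τ) x) ≤ 0 := by
  obtain ⟨-, a₀, c₀, -, hc₀, hcoercive⟩ := hf
  filter_upwards [tendsto_norm_cobounded_atTop.eventually_ge_atTop √(a₀ / c₀)] with x hx
  rw [Real.sqrt_le_left (norm_nonneg x), div_le_iff₀ hc₀] at hx
  rw [inner_neg_right, real_inner_comm]
  linarith [hcoercive τ hτ x]

end IsCoerciveC3

theorem mainTheorem2 {n : ℕ} {T : ℝ} (hT : 0 < T)
    (f : ℝ → EuclideanSpace ℝ (Fin n) → ℝ) (hf : IsCoerciveC3 T f)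
    (τ : ℝ) (ξ : EuclideanSpace ℝ (Fin n)) (hZ : (τ, ξ) ∈ degenerateSet T f)
    (hpos : (hessianMatrix (f τ) ξ).PosSemidef)
    (l : EuclideanSpace ℝ (Fin n)) (hl : l ≠ 0)
    (ha : LinearMap.ker (Matrix.toEuclideanLin (hessianMatrix (f τ) ξ)) = Submodule.span ℝ {l})
    (hc : cubicTerm (f τ) ξ l ≠ 0) :
    ∃ w : ℝ → EuclideanSpace ℝ (Fin n),
      IsSolutionIssuingFrom (f τ) ξ univ w ∧
      ∀ (I : Set ℝ) (v : ℝ → EuclideanSpace ℝ (Fin n)),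
        IsSolutionIssuingFrom (f τ) ξ I v → ∃ c : ℝ, ∀ s ∈ I, v s = w (s + c) := by
  obtain ⟨hτ, hcrit, -⟩ := hZ
  have hg : ContDiff ℝ 3 (f τ) := hf.contDiff hτ
  simpa only [isSolutionIssuingFrom_iff] using
    mainTheorem2_general (isSaddleNode_neg_gradient hg hcrit hpos ha hc)
      ((contDiff_gradient (k := 2) hg).neg.of_le one_le_two)
      (hf.eventually_inner_neg_gradient_nonpos hτ)
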